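/- Let $n\in\mathbb N$, $T>0$, let $H=H(t,p)$ be a real function of class $C^1$ on $[0,T]\times\mathbb R^n$ and let $\sigma:\mathbb R^n\to\mathbb R$ be convex and of class $C^1$. Let $\sigma^*(q)=\sup_{y\in\mathbb R^n}\{\langle y,q\rangle-\sigma(y)\}\in(-\infty,+\infty]$ be the Fenchel conjugate of $\sigma$, and put $$\varphi(t,x,q)=\langle x,q\rangle-\sigma^*(q)-\int_0^tH(\tau,q)\,d\tau,\qquad u(t,x)=\max_{q\in\mathbb R^n}\varphi(t,x,q)$$ (the Hopf-type formula for the Cauchy problem $u_t+H(t,D_xu)=0$, $u(0,\cdot)=\sigma$). Let $\ell(t,x)$ be the set of all $p\in\mathbb R^n$ at which $\varphi(t,x,\cdot)$ attains its maximum. Assume: (A1) for every $(t_0,x_0)\in[0,T)\times\mathbb R^n$ there are $r,N>0$ such that $\varphi(t,x,p)<\max_{|q|\le N}\varphi(t,x,q)$ whenever $(t,x)\in[0,T)\times\mathbb R^n$, $|t-t_0|+|x-x_0|<r$ and $|p|>N$; (A2) either (a) $H(t,\cdot)$ is convex for all $t\in(0,T)$, or $H(t,\cdot)$ is concave for all $t\in(0,T)$;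 or (b) $H(t,p)=g(t)h(p)+k(t)$ for $t\in(0,T)$, $p\in\mathbb R^n$, with some functions $g,h,k$ such that $g\ge0$ on $(0,T)$ or $g\le0$ on $(0,T)$; and that $\sigma$ is Lipschitz on $\mathbb R^n$. Let $0<t_*\le T$ and suppose that $\ell(t_*,x)$ is a singleton for every $x\in\mathbb R^n$. Then on the open strip $(0,t_*)\times\mathbb R^n$ the maximum defining $u$ is attained and finite, and $u$ is continuously differentiable there. -/

import Mathlib

noncomputable section

/-- The Fenchel conjugate `σ*(q) = sup_y (⟨y, q⟩ - σ(y))`, with values in `[-∞, +∞]`. -/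
def fenchelConj {n : ℕ} (σ : EuclideanSpace ℝ (Fin n) → ℝ)
    (q : EuclideanSpace ℝ (Fin n)) : EReal :=
  ⨆ y : EuclideanSpace ℝ (Fin n), ((inner ℝ y q - σ y : ℝ) : EReal)

/-- `φ(t,x,q) = ⟨x, q⟩ - σ*(q) - ∫₀ᵗ H(τ,q) dτ`, which is `-∞` exactly when `σ*(q) = +∞`.
The finite terms are collected first; as `σ*` never takes the value `-∞`, the subtraction
in `EReal` is never of the form `∞ - ∞`. -/
def hopfPhi {n : ℕ} (H : ℝ → EuclideanSpace ℝ (Fin n) → ℝ) (σ : EuclideanSpace ℝ (Fin n) → ℝ)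
    (t : ℝ) (x q : EuclideanSpace ℝ (Fin n)) : EReal :=
  ((inner ℝ x q - ∫ τ in (0 : ℝ)..t, H τ q : ℝ) : EReal) - fenchelConj σ q

/-- The set `ℓ(t,x)` of all points at which `φ(t,x,·)` attains its maximum over `ℝⁿ`. -/
def hopfMaximizers {n : ℕ} (H : ℝ → EuclideanSpace ℝ (Fin n) → ℝ)
    (σ : EuclideanSpace ℝ (Fin n) → ℝ) (t : ℝ) (x : EuclideanSpace ℝ (Fin n)) :
    Set (EuclideanSpace ℝ (Fin n)) :=
  {p | ∀ q, hopfPhi H σ t x q ≤ hopfPhi H σ t x p}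

/-- The Hopf-type formula `u(t,x) = max_q φ(t,x,q)`, as a real number
(meaningful where the supremum is finite). -/
def hopfU {n : ℕ} (H : ℝ → EuclideanSpace ℝ (Fin n) → ℝ) (σ : EuclideanSpace ℝ (Fin n) → ℝ)
    (t : ℝ) (x : EuclideanSpace ℝ (Fin n)) : ℝ :=
  (⨆ q : EuclideanSpace ℝ (Fin n), hopfPhi H σ t x q).toReal

/-- Condition (A1): locally uniformly in `(t,x) ∈ [0,T) × ℝⁿ`, the values of `φ(t,x,·)` outside
some ball are smaller than its maximum over that ball. -/
def CondA1 {n : ℕ} (T : ℝ) (H : ℝ → EuclideanSpace ℝ (Fin n) → ℝ)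
    (σ : EuclideanSpace ℝ (Fin n) → ℝ) : Prop :=
  ∀ t₀ ∈ Set.Ico 0 T, ∀ x₀ : EuclideanSpace ℝ (Fin n), ∃ r > (0 : ℝ), ∃ N > (0 : ℝ),
    ∀ t ∈ Set.Ico 0 T, ∀ x : EuclideanSpace ℝ (Fin n), |t - t₀| + ‖x - x₀‖ < r →
      ∀ p : EuclideanSpace ℝ (Fin n), N < ‖p‖ →
        hopfPhi H σ t x p < ⨆ q ∈ Metric.closedBall (0 : EuclideanSpace ℝ (Fin n)) N,
          hopfPhi H σ t x q

/-- Condition (A2): `H(t,·)` is convex for all `t ∈ (0,T)`, or concave for all `t ∈ (0,T)`, or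
`H(t,p) = g(t) h(p) + k(t)` where `g` does not change sign on `(0,T)`. -/
def CondA2 {n : ℕ} (T : ℝ) (H : ℝ → EuclideanSpace ℝ (Fin n) → ℝ) : Prop :=
  ((∀ t ∈ Set.Ioo 0 T, ConvexOn ℝ Set.univ (H t)) ∨
    (∀ t ∈ Set.Ioo 0 T, ConcaveOn ℝ Set.univ (H t))) ∨
  ∃ (g : ℝ → ℝ) (h : EuclideanSpace ℝ (Fin n) → ℝ) (k : ℝ → ℝ),
    (∀ t ∈ Set.Ioo 0 T, ∀ p, H t p = g t * h p + k t) ∧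
    ((∀ t ∈ Set.Ioo 0 T, 0 ≤ g t) ∨ (∀ t ∈ Set.Ioo 0 T, g t ≤ 0))

end

open Set Filter Topology

section Conjugate

variable {E : Type*} [NormedAddCommGroup E] [InnerProductSpace ℝ E]

/-- The effective domain of the Fenchel conjugate. -/
def conjDom (σ : E → ℝ) : Set E :=
  {q | BddAbove (range fun y => inner ℝ y q - σ y)}

/-- The real value of the Fenchel conjugate, meaningful on `conjDom σ`. -/
noncomputable def conjVal (σ : E → ℝ) (q : E) : ℝ :=
  ⨆ y, (inner ℝ y q - σ y)

theorem le_conjVal {σ : E → ℝ} {q : E} (hq : q ∈ conjDom σ) (y : E) :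
    inner ℝ y q - σ y ≤ conjVal σ q :=
  le_ciSup hq y

theorem conjVal_le {σ : E → ℝ} {q : E} {c : ℝ} (h : ∀ y, inner ℝ y q - σ y ≤ c) :
    conjVal σ q ≤ c :=
  ciSup_le h

theorem mem_conjDom {σ : E → ℝ} {q : E} {c : ℝ} (h : ∀ y, inner ℝ y q - σ y ≤ c) :
    q ∈ conjDom σ :=
  ⟨c, by rintro _ ⟨y, rfl⟩; exact h y⟩

theorem inner_sub_le_of_combo {σ : E → ℝ} {p q : E} (hp : p ∈ conjDom σ) (hq : q ∈ conjDom σ)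
    {a b : ℝ} (ha : 0 ≤ a) (hb : 0 ≤ b) (hab : a + b = 1) (y : E) :
    inner ℝ y (a • p + b • q) - σ y ≤ a * conjVal σ p + b * conjVal σ q := by
  have h1 := mul_le_mul_of_nonneg_left (le_conjVal hp y) ha
  have h2 := mul_le_mul_of_nonneg_left (le_conjVal hq y) hb
  rw [inner_add_right, real_inner_smul_right, real_inner_smul_right]
  have h3 : σ y = a * σ y + b * σ y := by rw [← add_mul, hab, one_mul]
  linarith

theorem convex_conjDom (σ : E → ℝ) : Convex ℝ (conjDom σ) :=
  fun _ hp _ hq _ _ ha hb hab => mem_conjDom (inner_sub_le_of_combo hp hq ha hb hab)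

theorem convexOn_conjVal (σ : E → ℝ) : ConvexOn ℝ (conjDom σ) (conjVal σ) :=
  ⟨convex_conjDom σ, fun _ hp _ hq _ _ ha hb hab =>
    conjVal_le (inner_sub_le_of_combo hp hq ha hb hab)⟩

theorem norm_le_of_mem_conjDom {σ : E → ℝ} {K : NNReal} (hσ : LipschitzWith K σ) {q : E}
    (hq : q ∈ conjDom σ) : ‖q‖ ≤ K := by
  by_contra! hlt
  have hpos : 0 < ‖q‖ := lt_of_le_of_lt K.coe_nonneg hlt
  set c := conjVal σ q + σ 0 with hc
  have key : ∀ r : ℝ, 0 ≤ r → r * (‖q‖ * (‖q‖ - K)) ≤ c := by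
    intro r hr
    have h1 := le_conjVal hq (r • q)
    have h2 := hσ.dist_le_mul (r • q) 0
    rw [Real.dist_eq, dist_zero_right, norm_smul, Real.norm_of_nonneg hr] at h2
    rw [real_inner_smul_left, real_inner_self_eq_norm_sq] at h1
    have h3 := le_abs_self (σ (r • q) - σ 0)
    nlinarith
  have hd : 0 < ‖q‖ * (‖q‖ - K) := mul_pos hpos (sub_pos.2 hlt)
  have h := key ((|c| + 1) / (‖q‖ * (‖q‖ - K))) (by positivity)
  rw [div_mul_cancel₀ _ hd.ne'] at h
  linarith [le_abs_self c]

/-- First order optimality for the sum of a convex and a differentiable function. -/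
theorem ConvexOn.sub_fderiv_le_of_isMinOn_add {D : Set E} {a G : E → ℝ} {G' : E →L[ℝ] ℝ} {p : E}
    (ha : ConvexOn ℝ D a) (hp : p ∈ D) (hG : HasFDerivAt G G' p)
    (hmin : ∀ q ∈ D, a p + G p ≤ a q + G q) {q : E} (hq : q ∈ D) :
    a p - G' (q - p) ≤ a q := by
  have hline : HasDerivAt (fun r : ℝ => G (p + r • (q - p))) (G' (q - p)) 0 := by
    have h1 : HasDerivAt (fun r : ℝ => p + r • (q - p)) (q - p) 0 := by
      simpa using ((hasDerivAt_id (0 : ℝ)).smul_const (q - p)).const_add p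
    have h2 : HasFDerivAt G G' (p + (0 : ℝ) • (q - p)) := by simpa using hG
    exact h2.comp_hasDerivAt (0 : ℝ) h1
  have hlim := hline.tendsto_slope_zero_right
  have hev : ∀ᶠ r : ℝ in 𝓝[>] 0,
      a p - a q ≤ r⁻¹ • (G (p + (0 + r) • (q - p)) - G (p + (0 : ℝ) • (q - p))) := by
    filter_upwards [Ioo_mem_nhdsGT (zero_lt_one' ℝ)] with r hr
    have hcomb : p + r • (q - p) = (1 - r) • p + r • q := by module
    have hconv := ha.2 hp hq (sub_nonneg.2 hr.2.le) hr.1.le (by ring)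
    have hmem := ha.1 hp hq (sub_nonneg.2 hr.2.le) hr.1.le (by ring)
    have hm := hmin _ hmem
    rw [zero_add, hcomb, zero_smul, add_zero, smul_eq_mul, inv_mul_eq_div, le_div_iff₀ hr.1]
    simp only [smul_eq_mul] at hconv
    linarith
  linarith [ge_of_tendsto hlim hev]

theorem ConvexOn.add_fderiv_le {σ : E → ℝ} (hσ : ConvexOn ℝ univ σ) {σ' : E →L[ℝ] ℝ} {y : E}
    (h : HasFDerivAt σ σ' y) (z : E) : σ y + σ' (z - y) ≤ σ z := by
  have := hσ.sub_fderiv_le_of_isMinOn_add (mem_univ y) h.neg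
    (fun q _ => by simp) (mem_univ z)
  simp only [neg_apply, sub_neg_eq_add] at this
  exact this

/-- `p` maximizes `b - σ*`, where `σ*` is the Fenchel conjugate of `σ`. -/
def IsConjMax (σ : E → ℝ) (b : E → ℝ) (p : E) : Prop :=
  p ∈ conjDom σ ∧ ∀ r ∈ conjDom σ, b r - conjVal σ r ≤ b p - conjVal σ p

theorem isConjMax_of_forall_le {σ b : E → ℝ} {p : E} (hne : (conjDom σ).Nonempty)
    (h : ∀ r ∈ conjDom σ, ∀ y, inner ℝ y p - σ y ≤ b p - b r + conjVal σ r) :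
    IsConjMax σ b p := by
  obtain ⟨r₀, hr₀⟩ := hne
  refine ⟨mem_conjDom (h r₀ hr₀), fun r hr => ?_⟩
  linarith [conjVal_le (h r hr)]

theorem IsConjMax.inner_sub_le {σ b : E → ℝ} {p : E} (h : IsConjMax σ b p) {r : E}
    (hr : r ∈ conjDom σ) (y : E) : inner ℝ y p - σ y ≤ b p - b r + conjVal σ r := by
  linarith [h.2 r hr, le_conjVal h.1 y]

/-- Danskin's theorem for a maximizer depending continuously on the parameter. -/
theorem hasFDerivAt_of_isConjMax {Z : Type*} [NormedAddCommGroup Z] [NormedSpace ℝ Z] {σ : E → ℝ}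
    {b : Z → E → ℝ} {b' : Z → E → Z →L[ℝ] ℝ} (hb : ∀ z q, HasFDerivAt (fun w => b w q) (b' z q) z)
    (hb' : Continuous fun w : Z × E => b' w.1 w.2) {U : Set Z} (hU : IsOpen U) {P : Z → E}
    (hP : ∀ z ∈ U, IsConjMax σ (b z) (P z)) (hPc : ContinuousOn P U) {z : Z} (hz : z ∈ U) :
    HasFDerivAt (fun w => b w (P w) - conjVal σ (P w)) (b' z (P z)) z := by
  have hUz : U ∈ 𝓝 z := hU.mem_nhds hz
  rw [hasFDerivAt_iff_isLittleO, Asymptotics.isLittleO_iff]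
  intro ε hε
  have hnear : ∀ᶠ w : Z × E in 𝓝 z ×ˢ 𝓝 (P z), ‖b' w.1 w.2 - b' z (P z)‖ ≤ ε := by
    rw [← nhds_prod_eq]
    have h := (hb'.tendsto (z, P z)).sub_const (b' z (P z))
    rw [sub_self] at h
    filter_upwards [h.norm.eventually (gt_mem_nhds (by simpa using hε))] with w hw using hw.le
  obtain ⟨A, hA, B, hB, hAB⟩ := eventually_prod_iff.1 hnear
  obtain ⟨δ, hδ, hball⟩ := Metric.eventually_nhds_iff_ball.1 hA
  have hmv : ∀ q, B q → ∀ w ∈ Metric.ball z δ,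
      |b w q - b z q - b' z (P z) (w - z)| ≤ ε * ‖w - z‖ := by
    intro q hq w hw
    exact (convex_ball z δ).norm_image_sub_le_of_norm_hasFDerivWithin_le'
      (fun x _ => (hb x q).hasFDerivWithinAt) (fun x hx => hAB (hball x hx) hq)
      (Metric.mem_ball_self hδ) hw
  filter_upwards [Metric.ball_mem_nhds z hδ, hUz, (hPc.continuousAt hUz).eventually hB]
    with w hw hwU hBw
  have h1 := abs_le.1 (hmv _ hB.self_of_nhds w hw)
  have h2 := abs_le.1 (hmv _ hBw w hw)
  have h3 := (hP w hwU).2 _ (hP z hz).1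
  have h4 := (hP z hz).2 _ (hP w hwU).1
  rw [Real.norm_eq_abs, abs_le]
  constructor <;> linarith [h1.1, h1.2, h2.1, h2.2]

theorem contDiffOn_one_of_isConjMax {Z : Type*} [NormedAddCommGroup Z] [NormedSpace ℝ Z]
    {σ : E → ℝ} {b : Z → E → ℝ} {b' : Z → E → Z →L[ℝ] ℝ}
    (hb : ∀ z q, HasFDerivAt (fun w => b w q) (b' z q) z)
    (hb' : Continuous fun w : Z × E => b' w.1 w.2) {U : Set Z} (hU : IsOpen U) {P : Z → E}
    (hP : ∀ z ∈ U, IsConjMax σ (b z) (P z)) (hPc : ContinuousOn P U) :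
    ContDiffOn ℝ 1 (fun w => b w (P w) - conjVal σ (P w)) U := by
  have hderiv := fun z (hz : z ∈ U) => hasFDerivAt_of_isConjMax hb hb' hU hP hPc hz
  rw [show (1 : WithTop ℕ∞) = 0 + 1 from (zero_add 1).symm]
  refine (contDiffOn_succ_iff_fderiv_of_isOpen hU).2
    ⟨fun z hz => (hderiv z hz).differentiableAt.differentiableWithinAt, by simp, ?_⟩
  refine contDiffOn_zero.2 (ContinuousOn.congr ?_ fun z hz => (hderiv z hz).fderiv)
  exact hb'.comp_continuousOn (continuousOn_id.prodMk hPc)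

theorem eq_of_fenchel_eq {σ : E → ℝ} (hσd : Differentiable ℝ σ) {p q y : E}
    (hp : p ∈ conjDom σ) (hq : q ∈ conjDom σ) (hpy : conjVal σ p = inner ℝ y p - σ y)
    (hqy : conjVal σ q = inner ℝ y q - σ y) : p = q := by
  have key : ∀ r ∈ conjDom σ, conjVal σ r = inner ℝ y r - σ y → innerSL ℝ r = fderiv ℝ σ y := by
    intro r hr hry
    have hd : HasFDerivAt (fun z => σ z - innerSL ℝ r z) (fderiv ℝ σ y - innerSL ℝ r) y :=
      (hσd y).hasFDerivAt.sub ((innerSL ℝ r).hasFDerivAt)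
    have hmin : IsLocalMin (fun z => σ z - innerSL ℝ r z) y := by
      refine Eventually.of_forall fun z => ?_
      have := le_conjVal hr z
      simp only [innerSL_apply_apply, real_inner_comm z r, real_inner_comm y r]
      rw [hry] at this
      linarith
    exact (sub_eq_zero.1 (hmin.hasFDerivAt_eq_zero hd)).symm
  refine ext_inner_right ℝ fun w => ?_
  have := congrArg (fun L : E →L[ℝ] ℝ => L w) ((key p hp hpy).trans (key q hq hqy).symm)
  simpa using this

variable [FiniteDimensional ℝ E]

theorem exists_isConjMax {σ : E → ℝ} {K : NNReal} (hσ : LipschitzWith K σ)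
    (hne : (conjDom σ).Nonempty) {b : E → ℝ} (hb : Continuous b) : ∃ p, IsConjMax σ b p := by
  have : ProperSpace E := FiniteDimensional.proper_real E
  let ψ : E → EReal := fun q => ⨅ y, ((b q - (inner ℝ y q - σ y) : ℝ) : EReal)
  have husc : UpperSemicontinuous ψ := by
    refine upperSemicontinuous_iInf fun y => Continuous.upperSemicontinuous ?_
    exact continuous_coe_real_ereal.comp (by fun_prop)
  obtain ⟨p, -, hp⟩ := (husc.upperSemicontinuousOn (Metric.closedBall (0 : E) K)).exists_isMaxOn
    ⟨0, by simp⟩ (isCompact_closedBall _ _)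
  refine ⟨p, isConjMax_of_forall_le hne fun r hr y => ?_⟩
  have h1 : ((b r - conjVal σ r : ℝ) : EReal) ≤ ψ r :=
    le_iInf fun y => EReal.coe_le_coe_iff.2 (by linarith [le_conjVal hr y])
  have h2 : ψ r ≤ ψ p := hp (by simpa using norm_le_of_mem_conjDom hσ hr)
  have h3 : ψ p ≤ ((b p - (inner ℝ y p - σ y) : ℝ) : EReal) := iInf_le _ y
  have := EReal.coe_le_coe_iff.1 (h1.trans (h2.trans h3))
  linarith

theorem continuousOn_of_isConjMax {Z : Type*} [TopologicalSpace Z] {σ : E → ℝ} {K : NNReal}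
    (hσ : LipschitzWith K σ) {b : Z → E → ℝ} (hb : Continuous fun w : Z × E => b w.1 w.2)
    {U : Set Z} {P : Z → E} (hP : ∀ z ∈ U, IsConjMax σ (b z) (P z))
    (huniq : ∀ z ∈ U, ∀ q, IsConjMax σ (b z) q → q = P z) : ContinuousOn P U := by
  have : ProperSpace E := FiniteDimensional.proper_real E
  intro z hz
  refine (isCompact_closedBall (0 : E) K).tendsto_nhds_of_unique_mapClusterPt
    (eventually_nhdsWithin_of_forall fun w hw => by
      simpa using norm_le_of_mem_conjDom hσ (hP w hw).1) fun q _ hq => huniq z hz q ?_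
  obtain ⟨V, hV, hVq⟩ := mapClusterPt_iff_ultrafilter.1 hq
  have hVz : Tendsto (fun w : Z => w) V (𝓝 z) := hV.trans nhdsWithin_le_nhds
  have hVU : ∀ᶠ w in (V : Filter Z), w ∈ U := hV self_mem_nhdsWithin
  refine isConjMax_of_forall_le ⟨_, (hP z hz).1⟩ fun r hr y => ?_
  have hleft : Tendsto (fun w => inner ℝ y (P w) - σ y) V (𝓝 (inner ℝ y q - σ y)) :=
    (tendsto_const_nhds.inner hVq).sub_const _
  have hb1 : Tendsto (fun w => b w (P w)) V (𝓝 (b z q)) :=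
    (hb.tendsto (z, q)).comp (hVz.prodMk_nhds hVq)
  have hb2 : Tendsto (fun w => b w r) V (𝓝 (b z r)) :=
    (hb.tendsto (z, r)).comp (hVz.prodMk_nhds tendsto_const_nhds)
  refine le_of_tendsto_of_tendsto hleft ((hb1.sub hb2).add_const _) ?_
  filter_upwards [hVU] with w hw
  exact (hP w hw).inner_sub_le hr y

/-- If `⟨x, ·⟩ - σ* - F` has a unique maximizer for every `x`, then `σ* + F` is convex. -/
theorem convexOn_conjVal_add {σ : E → ℝ} {K : NNReal} (hσ : LipschitzWith K σ) {F : E → ℝ}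
    (hF : Continuous F)
    (huniq : ∀ x, ∃ p, ∀ q, IsConjMax σ (fun r => inner ℝ x r - F r) q ↔ q = p) :
    ConvexOn ℝ (conjDom σ) (fun q => conjVal σ q + F q) := by
  have : ProperSpace E := FiniteDimensional.proper_real E
  choose P hP using huniq
  have hPmax : ∀ x, IsConjMax σ (fun r => inner ℝ x r - F r) (P x) := fun x => (hP x _).2 rfl
  have hPc : ContinuousOn P univ :=
    continuousOn_of_isConjMax (b := fun x r => inner ℝ x r - F r) hσ (by fun_prop)
      (fun x _ => hPmax x) (fun x _ q hq => (hP x q).1 hq)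
  set v : E → ℝ := fun x => inner ℝ x (P x) - F (P x) - conjVal σ (P x) with hv
  have hvd : ∀ x, HasFDerivAt v (innerSL ℝ (P x)) x := fun x =>
    hasFDerivAt_of_isConjMax (b := fun x r => inner ℝ x r - F r) (b' := fun _ q => innerSL ℝ q)
      (fun x q => by
        have h := ((innerSL ℝ q).hasFDerivAt (x := x)).sub_const (F q)
        refine h.congr_of_eventuallyEq (Eventually.of_forall fun w => ?_)
        simp [real_inner_comm])
      (by fun_prop) isOpen_univ (fun x _ => hPmax x) hPc (mem_univ x)
  have hvc : Continuous v := continuous_iff_continuousAt.2 fun x => (hvd x).continuousAt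
  refine ⟨convex_conjDom σ, fun p₁ h₁ p₂ h₂ a₁ a₂ ha₁ ha₂ ha => ?_⟩
  set p := a₁ • p₁ + a₂ • p₂ with hp
  set c := a₁ • (conjVal σ p₁ + F p₁) + a₂ • (conjVal σ p₂ + F p₂) with hc
  have hvp : ∀ x, inner ℝ x p - v x ≤ c := by
    intro x
    have e1 := mul_le_mul_of_nonneg_left ((hPmax x).2 p₁ h₁) ha₁
    have e2 := mul_le_mul_of_nonneg_left ((hPmax x).2 p₂ h₂) ha₂
    have e3 : v x = a₁ * v x + a₂ * v x := by rw [← add_mul, ha, one_mul]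
    simp only [hp, hc, inner_add_right, real_inner_smul_right, smul_eq_mul]
    simp only [hv] at e3 ⊢
    linarith
  obtain ⟨B, hB⟩ := (isCompact_closedBall (0 : E) K).bddBelow_image hF.continuousOn
  have hΦ : ∀ q ∈ conjDom σ, B - σ 0 ≤ conjVal σ q + F q := by
    intro q hq
    have e1 : B ≤ F q := hB ⟨q, by simpa using norm_le_of_mem_conjDom hσ hq, rfl⟩
    have e2 := le_conjVal hq 0
    rw [inner_zero_left] at e2
    linarith
  have hreg : ∀ ε : ℝ, 0 < ε → ∃ q ∈ conjDom σ, conjVal σ q + F q ≤ c ∧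
      ‖q - p‖ ^ 2 ≤ ε * (c - (B - σ 0)) := by
    intro ε hε
    set m : E → ℝ := fun x => v x - inner ℝ p x + ε / 2 * ‖x‖ ^ 2 with hm
    have hmc : Continuous m := by fun_prop
    have hmt : Tendsto m (cocompact E) atTop := by
      have h1 : Tendsto (fun x : E => -c + ε / 2 * ‖x‖ ^ 2) (cocompact E) atTop :=
        tendsto_atTop_add_const_left _ _ (((tendsto_pow_atTop two_ne_zero).comp
          (tendsto_norm_cocompact_atTop (E := E))).const_mul_atTop (half_pos hε))
      refine tendsto_atTop_mono (fun x => ?_) h1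
      have := hvp x
      rw [real_inner_comm] at this
      simp only [hm]
      linarith
    obtain ⟨x, hx⟩ := hmc.exists_forall_le hmt
    have hmd : HasFDerivAt m (innerSL ℝ (P x) - innerSL ℝ p + (ε / 2) • (2 • innerSL ℝ x))
        x := by
      refine ((hvd x).sub ((innerSL ℝ p).hasFDerivAt (x := x))).add (HasFDerivAt.const_mul ?_ _)
      have := (hasStrictFDerivAt_norm_sq x).hasFDerivAt
      simpa using this
    have hzero := IsLocalMin.hasFDerivAt_eq_zero (Eventually.of_forall hx) hmd
    have hPx : P x - p = -(ε • x) := by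
      refine ext_inner_right ℝ fun w => ?_
      have := congrArg (fun L : E →L[ℝ] ℝ => L w) hzero
      simp at this
      rw [inner_sub_left, inner_neg_left, real_inner_smul_left]
      linarith
    have hval : conjVal σ (P x) + F (P x) ≤ c - ε * ‖x‖ ^ 2 := by
      have e1 := hvp x
      have e2 : inner ℝ x (P x) = inner ℝ x p - ε * ‖x‖ ^ 2 := by
        have : P x = p - ε • x := by rw [sub_eq_iff_eq_add] at hPx; rw [hPx]; abel
        rw [this, inner_sub_right, real_inner_smul_right, real_inner_self_eq_norm_sq]
      simp only [hv] at e1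
      linarith
    refine ⟨P x, (hPmax x).1, hval.trans (by nlinarith [sq_nonneg ‖x‖]), ?_⟩
    rw [hPx, norm_neg, norm_smul, Real.norm_of_nonneg hε.le, mul_pow]
    have := hΦ _ (hPmax x).1
    nlinarith
  choose! Q hQD hQc hQn using hreg
  have hε : Tendsto (fun ε : ℝ => ε * (c - (B - σ 0))) (𝓝[>] 0) (𝓝 0) := by
    have : Tendsto (fun ε : ℝ => ε * (c - (B - σ 0))) (𝓝 0) (𝓝 (0 * (c - (B - σ 0)))) :=
      tendsto_id.mul_const _
    rw [zero_mul] at this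
    exact this.mono_left nhdsWithin_le_nhds
  have hQ : Tendsto Q (𝓝[>] 0) (𝓝 p) := by
    rw [tendsto_iff_norm_sub_tendsto_zero]
    have h1 : Tendsto (fun ε => ‖Q ε - p‖ ^ 2) (𝓝[>] 0) (𝓝 0) :=
      squeeze_zero' (Eventually.of_forall fun _ => by positivity)
        (eventually_nhdsWithin_of_forall fun ε hε => hQn ε hε) hε
    simpa using h1.sqrt
  have hle : ∀ y, inner ℝ y p - σ y ≤ c - F p := by
    intro y
    have h1 : Tendsto (fun ε => inner ℝ y (Q ε) - σ y) (𝓝[>] 0) (𝓝 (inner ℝ y p - σ y)) :=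
      (tendsto_const_nhds.inner hQ).sub_const _
    have h2 : Tendsto (fun ε => c - F (Q ε)) (𝓝[>] 0) (𝓝 (c - F p)) :=
      ((hF.tendsto p).comp hQ).const_sub c
    refine le_of_tendsto_of_tendsto h1 h2 (eventually_nhdsWithin_of_forall fun ε hε => ?_)
    linarith [hQc ε hε, le_conjVal (hQD ε hε) y]
  linarith [conjVal_le hle]

/-- At a maximizer `p` of `G - σ*` with `G` differentiable, the supremum defining `σ*(p)` is
attained. -/
theorem IsConjMax.exists_fenchel_eq {σ : E → ℝ} (hσd : Differentiable ℝ σ)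
    (hσc : ConvexOn ℝ univ σ) {G : E → ℝ} {p : E} (hp : IsConjMax σ G p)
    (hG : DifferentiableAt ℝ G p) : ∃ y, conjVal σ p = inner ℝ y p - σ y := by
  set y := (InnerProductSpace.toDual ℝ E).symm (fderiv ℝ G p) with hy
  set q := (InnerProductSpace.toDual ℝ E).symm (fderiv ℝ σ y) with hq
  refine ⟨y, le_antisymm ?_ (le_conjVal hp.1 y)⟩
  have hbound : ∀ z, inner ℝ z q - σ z ≤ inner ℝ y q - σ y := by
    intro z
    have h := hσc.add_fderiv_le (hσd y).hasFDerivAt z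
    have h2 : fderiv ℝ σ y (z - y) = inner ℝ (z - y) q := by
      rw [real_inner_comm, hq, InnerProductSpace.toDual_symm_apply]
    rw [h2, inner_sub_left] at h
    linarith
  have hfo := (convexOn_conjVal σ).sub_fderiv_le_of_isMinOn_add hp.1 hG.hasFDerivAt.neg
    (fun r hr => by have := hp.2 r hr; simp only [Pi.neg_apply]; linarith) (mem_conjDom hbound)
  have h3 : fderiv ℝ G p (q - p) = inner ℝ y (q - p) := by
    rw [hy, InnerProductSpace.toDual_symm_apply]
  rw [neg_apply, h3, inner_sub_right] at hfo
  linarith [conjVal_le hbound]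

/-- The conjugate of a smooth convex function is strictly convex at the midpoints where some
differentiable perturbation of it is minimal. -/
theorem IsConjMax.conjVal_midpoint_lt {σ : E → ℝ} (hσd : Differentiable ℝ σ)
    (hσc : ConvexOn ℝ univ σ) {G : E → ℝ} {p₁ p₂ : E} (h₁ : p₁ ∈ conjDom σ) (h₂ : p₂ ∈ conjDom σ)
    (hne : p₁ ≠ p₂) (hp : IsConjMax σ G ((1 / 2 : ℝ) • p₁ + (1 / 2 : ℝ) • p₂))
    (hG : Differentiable ℝ G) :
    conjVal σ ((1 / 2 : ℝ) • p₁ + (1 / 2 : ℝ) • p₂) < (conjVal σ p₁ + conjVal σ p₂) / 2 := by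
  obtain ⟨y, hy⟩ := hp.exists_fenchel_eq hσd hσc (hG _)
  by_contra! hle
  rw [hy, inner_add_right, real_inner_smul_right, real_inner_smul_right] at hle
  have e1 := le_conjVal h₁ y
  have e2 := le_conjVal h₂ y
  exact hne (eq_of_fenchel_eq hσd h₁ h₂ (y := y) (by linarith) (by linarith))

end Conjugate

section Uniqueness

variable {E : Type*} [NormedAddCommGroup E] [InnerProductSpace ℝ E]

theorem ConvexOn.half_add_half_le {D : Set E} {f : E → ℝ} (hf : ConvexOn ℝ D f) {p₁ p₂ : E}
    (h₁ : p₁ ∈ D) (h₂ : p₂ ∈ D) :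
    f ((1 / 2 : ℝ) • p₁ + (1 / 2 : ℝ) • p₂) ≤ (f p₁ + f p₂) / 2 := by
  have := hf.2 h₁ h₂ (one_half_pos (α := ℝ)).le (one_half_pos (α := ℝ)).le (by norm_num)
  simp only [smul_eq_mul] at this
  linarith

theorem differentiable_inner_right (x : E) : Differentiable ℝ fun q : E => inner ℝ x q :=
  (innerSL ℝ x).differentiable

theorem IsConjMax.midpoint {σ b : E → ℝ} {p₁ p₂ : E} (h₁ : IsConjMax σ b p₁)
    (h₂ : IsConjMax σ b p₂)
    (hconv : (b p₁ - conjVal σ p₁ + (b p₂ - conjVal σ p₂)) / 2 ≤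
      b ((1 / 2 : ℝ) • p₁ + (1 / 2 : ℝ) • p₂) -
        conjVal σ ((1 / 2 : ℝ) • p₁ + (1 / 2 : ℝ) • p₂)) :
    IsConjMax σ b ((1 / 2 : ℝ) • p₁ + (1 / 2 : ℝ) • p₂) :=
  ⟨convex_conjDom σ h₁.1 h₂.1 (by norm_num) (by norm_num) (by norm_num), fun r hr => by
    linarith [h₁.2 r hr, h₂.2 r hr]⟩

variable [FiniteDimensional ℝ E]

/-- Uniqueness of the maximizer of `⟨x, ·⟩ - σ* - F` when `σ* + F` exceeds a midpoint convex
function by a positive multiple of `σ*`. -/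
theorem IsConjMax.unique_of_midpoint_convex {σ : E → ℝ} (hσd : Differentiable ℝ σ)
    (hσc : ConvexOn ℝ univ σ) {F : E → ℝ} (hF : Differentiable ℝ F) {κ : ℝ} (hκ : 0 < κ)
    (hR : ∀ p₁ ∈ conjDom σ, ∀ p₂ ∈ conjDom σ,
      (1 - κ) * conjVal σ ((1 / 2 : ℝ) • p₁ + (1 / 2 : ℝ) • p₂) +
        F ((1 / 2 : ℝ) • p₁ + (1 / 2 : ℝ) • p₂) ≤
      ((1 - κ) * conjVal σ p₁ + F p₁ + ((1 - κ) * conjVal σ p₂ + F p₂)) / 2)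
    {x p₁ p₂ : E} (h₁ : IsConjMax σ (fun q => inner ℝ x q - F q) p₁)
    (h₂ : IsConjMax σ (fun q => inner ℝ x q - F q) p₂) : p₁ = p₂ := by
  by_contra hne
  have hr := hR p₁ h₁.1 p₂ h₂.1
  have hs := mul_le_mul_of_nonneg_left ((convexOn_conjVal σ).half_add_half_le h₁.1 h₂.1) hκ.le
  have hin : inner ℝ x ((1 / 2 : ℝ) • p₁ + (1 / 2 : ℝ) • p₂) =
      (inner ℝ x p₁ + inner ℝ x p₂) / 2 := by
    rw [inner_add_right, real_inner_smul_right, real_inner_smul_right]; ring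
  have hmid := h₁.midpoint h₂ (by simp only [hin]; linarith)
  have hlt := hmid.conjVal_midpoint_lt hσd hσc h₁.1 h₂.1 hne
    ((differentiable_inner_right x).sub hF)
  have hlt' := mul_lt_mul_of_pos_left hlt hκ
  have e1 := h₁.2 _ hmid.1
  have e2 := hmid.2 _ h₁.1
  have e3 := h₂.2 _ hmid.1
  have e4 := hmid.2 _ h₂.1
  simp only [hin] at e1 e2 e3 e4
  linarith

/-- If `σ* + F₁` is convex with unique maximizers of `⟨x, ·⟩ - σ* - F₁`, and `F₀ - F₁` is midpoint
convex, then the maximizers of `⟨x, ·⟩ - σ* - F₀` are unique. -/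
theorem IsConjMax.unique_of_sub_midpoint_convex {σ : E → ℝ} {F₀ F₁ : E → ℝ}
    (hF₀ : Differentiable ℝ F₀) (hF₁ : Differentiable ℝ F₁)
    (hconv : ConvexOn ℝ (conjDom σ) (fun q => conjVal σ q + F₁ q))
    (huniq : ∀ x, ∃ p, ∀ q, IsConjMax σ (fun r => inner ℝ x r - F₁ r) q ↔ q = p)
    (hM : ∀ p₁ p₂, F₀ ((1 / 2 : ℝ) • p₁ + (1 / 2 : ℝ) • p₂) -
        F₁ ((1 / 2 : ℝ) • p₁ + (1 / 2 : ℝ) • p₂) ≤ (F₀ p₁ - F₁ p₁ + (F₀ p₂ - F₁ p₂)) / 2)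
    {x p₁ p₂ : E} (h₁ : IsConjMax σ (fun q => inner ℝ x q - F₀ q) p₁)
    (h₂ : IsConjMax σ (fun q => inner ℝ x q - F₀ q) p₂) : p₁ = p₂ := by
  have hm := hM p₁ p₂
  have hc := hconv.half_add_half_le h₁.1 h₂.1
  have hin : inner ℝ x ((1 / 2 : ℝ) • p₁ + (1 / 2 : ℝ) • p₂) =
      (inner ℝ x p₁ + inner ℝ x p₂) / 2 := by
    rw [inner_add_right, real_inner_smul_right, real_inner_smul_right]; ring
  have hmid := h₁.midpoint h₂ (by simp only [hin]; linarith)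
  have hm1 : p₁ - ((1 / 2 : ℝ) • p₁ + (1 / 2 : ℝ) • p₂) = (1 / 2 : ℝ) • (p₁ - p₂) := by module
  have hm2 : p₂ - ((1 / 2 : ℝ) • p₁ + (1 / 2 : ℝ) • p₂) = -((1 / 2 : ℝ) • (p₁ - p₂)) := by module
  have e1 := h₁.2 _ hmid.1
  have e2 := hmid.2 _ h₁.1
  have e3 := h₂.2 _ hmid.1
  have e4 := hmid.2 _ h₂.1
  simp only [hin] at e1 e2 e3 e4
  set p := (1 / 2 : ℝ) • p₁ + (1 / 2 : ℝ) • p₂ with hp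
  have hGd : DifferentiableAt ℝ (fun q => F₀ q - F₁ q - inner ℝ x q) p :=
    ((hF₀ p).sub (hF₁ p)).sub (differentiable_inner_right x p)
  set y := (InnerProductSpace.toDual ℝ E).symm
    (-fderiv ℝ (fun q => F₀ q - F₁ q - inner ℝ x q) p) with hy
  have hyG : ∀ w, -fderiv ℝ (fun q => F₀ q - F₁ q - inner ℝ x q) p w = inner ℝ y w := fun w => by
    rw [hy, InnerProductSpace.toDual_symm_apply, neg_apply]
  have hfo : ∀ q ∈ conjDom σ,
      conjVal σ p + F₁ p + inner ℝ y (q - p) ≤ conjVal σ q + F₁ q := by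
    intro q hq
    have := hconv.sub_fderiv_le_of_isMinOn_add hmid.1 hGd.hasFDerivAt
      (fun r hr => by
        have := hmid.2 r hr
        simp only at this ⊢
        linarith) hq
    rw [← hyG]
    linarith
  have i1 := hfo p₁ h₁.1
  have i2 := hfo p₂ h₂.1
  rw [hm1] at i1
  rw [hm2, inner_neg_right] at i2
  have hmax₁ : IsConjMax σ (fun r => inner ℝ y r - F₁ r) p₁ := by
    refine ⟨h₁.1, fun q hq => ?_⟩
    have := hfo q hq
    have hd : inner ℝ y p₁ - inner ℝ y p = inner ℝ y ((1 / 2 : ℝ) • (p₁ - p₂)) := by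
      rw [← inner_sub_right, hm1]
    rw [inner_sub_right] at this
    simp only
    linarith
  have hmax₂ : IsConjMax σ (fun r => inner ℝ y r - F₁ r) p₂ := by
    refine ⟨h₂.1, fun q hq => ?_⟩
    have := hfo q hq
    have hd : inner ℝ y p₂ - inner ℝ y p = -inner ℝ y ((1 / 2 : ℝ) • (p₁ - p₂)) := by
      rw [← inner_sub_right, hm2, inner_neg_right]
    rw [inner_sub_right] at this
    simp only
    linarith
  obtain ⟨p₀, hp₀⟩ := huniq y
  exact ((hp₀ _).1 hmax₁).trans ((hp₀ _).1 hmax₂).symm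

end Uniqueness

section TimeIntegral

variable {E : Type*} [NormedAddCommGroup E]

theorem continuous_timeIntegral {H : ℝ → E → ℝ} (hH : Continuous fun z : ℝ × E => H z.1 z.2) :
    Continuous fun z : ℝ × E => ∫ τ in (0 : ℝ)..z.1, H τ z.2 :=
  intervalIntegral.continuous_parametric_intervalIntegral_of_continuous
    (f := fun (z : ℝ × E) τ => H τ z.2) (by fun_prop) continuous_fst

theorem intervalIntegrable_slice {H : ℝ → E → ℝ} (hH : Continuous fun z : ℝ × E => H z.1 z.2)
    (q : E) (s t : ℝ) : IntervalIntegrable (fun τ => H τ q) MeasureTheory.volume s t :=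
  (by fun_prop : Continuous fun τ => H τ q).intervalIntegrable s t

theorem timeIntegral_sub {H : ℝ → E → ℝ} (hH : Continuous fun z : ℝ × E => H z.1 z.2)
    (q : E) (s t : ℝ) :
    (∫ τ in (0 : ℝ)..t, H τ q) - ∫ τ in (0 : ℝ)..s, H τ q = ∫ τ in s..t, H τ q :=
  intervalIntegral.integral_interval_sub_left (intervalIntegrable_slice hH q _ _)
    (intervalIntegrable_slice hH q _ _)

/-- For a separable integrand of constant sign, the earlier time integral is, up to a constant,
a multiple of the later one by a factor in `[0, 1]`. -/
theorem timeIntegral_eq_mul_add_of_separable {H : ℝ → E → ℝ}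
    (hH : Continuous fun z : ℝ × E => H z.1 z.2) {T : ℝ} {g k : ℝ → ℝ} {h : E → ℝ}
    (hsep : ∀ t ∈ Ioo 0 T, ∀ p, H t p = g t * h p + k t)
    (hg : (∀ t ∈ Ioo 0 T, 0 ≤ g t) ∨ (∀ t ∈ Ioo 0 T, g t ≤ 0))
    {s t : ℝ} (hs : 0 ≤ s) (hst : s ≤ t) (htT : t ≤ T) :
    ∃ θ c : ℝ, 0 ≤ θ ∧ θ ≤ 1 ∧
      ∀ q, ∫ τ in (0 : ℝ)..s, H τ q = θ * (∫ τ in (0 : ℝ)..t, H τ q) + c := by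
  by_cases hconst : ∀ q, h q = h 0
  · refine ⟨0, ∫ τ in (0 : ℝ)..s, H τ 0, le_rfl, zero_le_one, fun q => ?_⟩
    rw [zero_mul, zero_add]
    refine intervalIntegral.integral_congr_Ioo_of_le hs fun τ hτ => ?_
    have hτ' : τ ∈ Ioo 0 T := ⟨hτ.1, hτ.2.trans_le (hst.trans htT)⟩
    rw [hsep τ hτ' q, hsep τ hτ' 0, hconst q]
  push Not at hconst
  obtain ⟨q₁, hq₁⟩ := hconst
  have hq₁' : h q₁ - h 0 ≠ 0 := sub_ne_zero.2 hq₁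
  set e : ℝ → ℝ := fun r => ∫ τ in (0 : ℝ)..r, (H τ q₁ - H τ 0) with he
  have hei : ∀ a b, IntervalIntegrable (fun τ => H τ q₁ - H τ 0) MeasureTheory.volume a b :=
    fun a b => (intervalIntegrable_slice hH _ _ _).sub (intervalIntegrable_slice hH _ _ _)
  have hF : ∀ r, 0 ≤ r → r ≤ T → ∀ q, ∫ τ in (0 : ℝ)..r, H τ q =
      (h q - h 0) / (h q₁ - h 0) * e r + ∫ τ in (0 : ℝ)..r, H τ 0 := by
    intro r hr hrT q
    rw [he, ← intervalIntegral.integral_const_mul, ← intervalIntegral.integral_add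
      ((hei _ _).const_mul _) (intervalIntegrable_slice hH _ _ _)]
    refine intervalIntegral.integral_congr_Ioo_of_le hr fun τ hτ => ?_
    have hτ' : τ ∈ Ioo 0 T := ⟨hτ.1, hτ.2.trans_le hrT⟩
    simp only [hsep τ hτ']
    field_simp
    ring
  have hθ : ∃ θ : ℝ, 0 ≤ θ ∧ θ ≤ 1 ∧ e s = θ * e t := by
    have hadd : e s + ∫ τ in s..t, (H τ q₁ - H τ 0) = e t :=
      intervalIntegral.integral_add_adjacent_intervals (hei _ _) (hei _ _)
    have hd : ∀ τ ∈ Ioo 0 T, H τ q₁ - H τ 0 = g τ * (h q₁ - h 0) := fun τ hτ => by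
      rw [hsep τ hτ, hsep τ hτ]; ring
    have hsign : (∀ τ ∈ Ioo 0 T, 0 ≤ H τ q₁ - H τ 0) ∨ (∀ τ ∈ Ioo 0 T, H τ q₁ - H τ 0 ≤ 0) := by
      rcases hg with hg | hg <;> rcases lt_or_gt_of_ne hq₁' with hlt | hlt
      · exact .inr fun τ hτ => hd τ hτ ▸ mul_nonpos_of_nonneg_of_nonpos (hg τ hτ) hlt.le
      · exact .inl fun τ hτ => hd τ hτ ▸ mul_nonneg (hg τ hτ) hlt.le
      · exact .inl fun τ hτ => hd τ hτ ▸ mul_nonneg_of_nonpos_of_nonpos (hg τ hτ) hlt.le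
      · exact .inr fun τ hτ => hd τ hτ ▸ mul_nonpos_of_nonpos_of_nonneg (hg τ hτ) hlt.le
    have hpos : ∀ {f : ℝ → ℝ} {a b : ℝ}, 0 ≤ a → a ≤ b → b ≤ T →
        IntervalIntegrable f MeasureTheory.volume a b → (∀ τ ∈ Ioo 0 T, 0 ≤ f τ) →
        0 ≤ ∫ τ in a..b, f τ := by
      intro f a b ha hab hbT hf hf0
      have := intervalIntegral.integral_mono_on_of_le_Ioo hab
        (intervalIntegrable_const (c := (0 : ℝ))) hf
        fun τ hτ => hf0 τ ⟨ha.trans_lt hτ.1, hτ.2.trans_le hbT⟩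
      simpa using this
    by_cases het : e t = 0
    · refine ⟨0, le_rfl, zero_le_one, ?_⟩
      rw [zero_mul]
      rcases hsign with hsg | hsg
      · have a1 := hpos le_rfl hs (hst.trans htT) (hei _ _) hsg
        have a2 := hpos hs hst htT (hei _ _) hsg
        linarith
      · have a1 := hpos le_rfl hs (hst.trans htT) (hei _ _).neg fun τ hτ => neg_nonneg.2 (hsg τ hτ)
        have a2 := hpos hs hst htT (hei _ _).neg fun τ hτ => neg_nonneg.2 (hsg τ hτ)
        simp only [Pi.neg_apply, intervalIntegral.integral_neg] at a1 a2
        linarith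
    · refine ⟨e s / e t, ?_, ?_, (div_mul_cancel₀ _ het).symm⟩ <;> rcases hsign with hsg | hsg
      · have a1 := hpos le_rfl hs (hst.trans htT) (hei _ _) hsg
        have a2 := hpos le_rfl (hs.trans hst) htT (hei _ _) hsg
        exact div_nonneg a1 a2
      · have a1 := hpos le_rfl hs (hst.trans htT) (hei _ _).neg fun τ hτ => neg_nonneg.2 (hsg τ hτ)
        have a2 := hpos le_rfl (hs.trans hst) htT (hei _ _).neg fun τ hτ => neg_nonneg.2 (hsg τ hτ)
        simp only [Pi.neg_apply, intervalIntegral.integral_neg] at a1 a2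
        exact div_nonneg_of_nonpos (by linarith) (by linarith)
      · have a1 := hpos le_rfl (hs.trans hst) htT (hei _ _) hsg
        have a2 := hpos hs hst htT (hei _ _) hsg
        exact div_le_one_of_le₀ (by linarith) a1
      · have a1 := hpos le_rfl (hs.trans hst) htT (hei _ _).neg fun τ hτ => neg_nonneg.2 (hsg τ hτ)
        have a2 := hpos hs hst htT (hei _ _).neg fun τ hτ => neg_nonneg.2 (hsg τ hτ)
        simp only [Pi.neg_apply, intervalIntegral.integral_neg] at a1 a2
        have : e t < 0 := lt_of_le_of_ne (by linarith) het
        rw [div_le_one_of_neg this]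
        linarith
  obtain ⟨θ, hθ0, hθ1, hθe⟩ := hθ
  refine ⟨θ, (∫ τ in (0 : ℝ)..s, H τ 0) - θ * ∫ τ in (0 : ℝ)..t, H τ 0, hθ0, hθ1, fun q => ?_⟩
  rw [hF s hs (hst.trans htT) q, hF t (hs.trans hst) htT q, hθe]
  ring

variable [InnerProductSpace ℝ E]

theorem hasFDerivAt_hopfAction {H : ℝ → E → ℝ} (hH : Continuous fun z : ℝ × E => H z.1 z.2)
    (z : ℝ × E) (q : E) :
    HasFDerivAt (fun w : ℝ × E => inner ℝ w.2 q - ∫ τ in (0 : ℝ)..w.1, H τ q)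
      ((innerSL ℝ q).comp (ContinuousLinearMap.snd ℝ ℝ E) -
        H z.1 q • ContinuousLinearMap.fst ℝ ℝ E) z := by
  have h1 : HasFDerivAt (fun w : ℝ × E => inner ℝ w.2 q)
      ((innerSL ℝ q).comp (ContinuousLinearMap.snd ℝ ℝ E)) z := by
    have := ((innerSL ℝ q).comp (ContinuousLinearMap.snd ℝ ℝ E)).hasFDerivAt (x := z)
    refine this.congr_of_eventuallyEq (Eventually.of_forall fun w => ?_)
    simp [real_inner_comm]
  have hc : Continuous fun τ => H τ q := by fun_prop
  have h2 : HasDerivAt (fun t => ∫ τ in (0 : ℝ)..t, H τ q) (H z.1 q) z.1 :=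
    intervalIntegral.integral_hasDerivAt_right (hc.intervalIntegrable _ _)
      (hc.stronglyMeasurableAtFilter _ _) hc.continuousAt
  exact h1.sub (h2.comp_hasFDerivAt z hasFDerivAt_fst)

theorem continuous_fderiv_hopfAction {H : ℝ → E → ℝ}
    (hH : Continuous fun z : ℝ × E => H z.1 z.2) :
    Continuous fun w : (ℝ × E) × E =>
      (innerSL ℝ w.2).comp (ContinuousLinearMap.snd ℝ ℝ E) -
        H w.1.1 w.2 • ContinuousLinearMap.fst ℝ ℝ E := by
  have h1 : Continuous fun w : (ℝ × E) × E => H w.1.1 w.2 :=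
    hH.comp (by fun_prop : Continuous fun w : (ℝ × E) × E => (w.1.1, w.2))
  have h2 : Continuous fun w : (ℝ × E) × E =>
      (innerSL ℝ w.2).comp (ContinuousLinearMap.snd ℝ ℝ E) :=
    ((innerSL ℝ).continuous.comp continuous_snd).clm_comp continuous_const
  exact h2.sub (h1.smul continuous_const)

theorem differentiable_timeIntegral [FiniteDimensional ℝ E] {H : ℝ → E → ℝ}
    {A : ℝ → E → E →L[ℝ] ℝ}
    (hH : Continuous fun z : ℝ × E => H z.1 z.2) (hA : Continuous fun z : ℝ × E => A z.1 z.2)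
    (hHA : ∀ τ q, HasFDerivAt (H τ) (A τ q) q) (t : ℝ) :
    Differentiable ℝ fun q => ∫ τ in (0 : ℝ)..t, H τ q := by
  have : ProperSpace E := FiniteDimensional.proper_real E
  intro q
  obtain ⟨C, hC⟩ := (isCompact_uIcc.prod (isCompact_closedBall q 1)).exists_bound_of_continuousOn
    (f := fun z : ℝ × E => A z.1 z.2) (s := uIcc 0 t ×ˢ Metric.closedBall q 1) hA.continuousOn
  have hAq : Continuous fun τ => A τ q := by fun_prop
  exact (intervalIntegral.hasFDerivAt_integral_of_dominated_of_fderiv_le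
    (F := fun q τ => H τ q) (F' := fun q τ => A τ q) (bound := fun _ => C)
    (Metric.closedBall_mem_nhds q one_pos)
    (Eventually.of_forall fun p => (by fun_prop : Continuous fun τ => H τ p).aestronglyMeasurable)
    (intervalIntegrable_slice hH q 0 t) hAq.aestronglyMeasurable
    (Eventually.of_forall fun τ hτ p hp => hC (τ, p) ⟨uIoc_subset_uIcc hτ, hp⟩)
    intervalIntegrable_const
    (Eventually.of_forall fun τ _ p _ => hHA τ p)).differentiableAt

theorem timeIntegral_midpoint_le {H : ℝ → E → ℝ} (hH : Continuous fun z : ℝ × E => H z.1 z.2)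
    {s t : ℝ} (hst : s ≤ t) (hconv : ∀ τ ∈ Ioo s t, ConvexOn ℝ univ (H τ)) (p₁ p₂ : E) :
    ∫ τ in s..t, H τ ((1 / 2 : ℝ) • p₁ + (1 / 2 : ℝ) • p₂) ≤
      ((∫ τ in s..t, H τ p₁) + ∫ τ in s..t, H τ p₂) / 2 := by
  rw [← intervalIntegral.integral_add (intervalIntegrable_slice hH _ _ _)
    (intervalIntegrable_slice hH _ _ _), ← intervalIntegral.integral_div]
  refine intervalIntegral.integral_mono_on_of_le_Ioo hst (intervalIntegrable_slice hH _ _ _)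
    (((intervalIntegrable_slice hH _ _ _).add (intervalIntegrable_slice hH _ _ _)).div_const 2)
    fun τ hτ => ?_
  exact (hconv τ hτ).half_add_half_le (mem_univ p₁) (mem_univ p₂)

end TimeIntegral

section Hopf

variable {n : ℕ}

local notation "𝔼" => EuclideanSpace ℝ (Fin n)

theorem fenchelConj_eq_coe {σ : 𝔼 → ℝ} {q : 𝔼} (hq : q ∈ conjDom σ) :
    fenchelConj σ q = (conjVal σ q : EReal) := by
  refine le_antisymm (iSup_le fun y => EReal.coe_le_coe_iff.2 (le_conjVal hq y)) ?_
  refine EReal.le_of_forall_lt_iff_le.1 fun z hz => ?_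
  refine EReal.coe_le_coe_iff.2 (conjVal_le fun y => ?_)
  exact EReal.coe_le_coe_iff.1 ((le_iSup (fun y => ((inner ℝ y q - σ y : ℝ) : EReal)) y).trans hz.le)

theorem fenchelConj_eq_top {σ : 𝔼 → ℝ} {q : 𝔼} (hq : q ∉ conjDom σ) :
    fenchelConj σ q = ⊤ := by
  refine EReal.eq_top_iff_forall_lt _ |>.2 fun c => ?_
  by_contra! hle
  exact hq (mem_conjDom (c := c) fun y => EReal.coe_le_coe_iff.1
    ((le_iSup (fun y => ((inner ℝ y q - σ y : ℝ) : EReal)) y).trans hle))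

theorem hopfPhi_eq_coe (H : ℝ → 𝔼 → ℝ) {σ : 𝔼 → ℝ} (t : ℝ) (x : 𝔼) {q : 𝔼}
    (hq : q ∈ conjDom σ) :
    hopfPhi H σ t x q =
      ((inner ℝ x q - (∫ τ in (0 : ℝ)..t, H τ q) - conjVal σ q : ℝ) : EReal) := by
  rw [hopfPhi, fenchelConj_eq_coe hq, ← EReal.coe_sub]

theorem hopfPhi_eq_bot (H : ℝ → 𝔼 → ℝ) {σ : 𝔼 → ℝ} (t : ℝ) (x : 𝔼) {q : 𝔼}
    (hq : q ∉ conjDom σ) : hopfPhi H σ t x q = ⊥ := by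
  rw [hopfPhi, fenchelConj_eq_top hq, EReal.sub_top]

theorem mem_hopfMaximizers_iff {H : ℝ → 𝔼 → ℝ} {σ : 𝔼 → ℝ} (hne : (conjDom σ).Nonempty)
    {t : ℝ} {x p : 𝔼} :
    p ∈ hopfMaximizers H σ t x ↔
      IsConjMax σ (fun q => inner ℝ x q - ∫ τ in (0 : ℝ)..t, H τ q) p := by
  constructor
  · intro h
    obtain ⟨q₀, hq₀⟩ := hne
    have hp : p ∈ conjDom σ := by
      by_contra hp
      have := h q₀
      rw [hopfPhi_eq_bot H t x hp, hopfPhi_eq_coe H t x hq₀, le_bot_iff] at this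
      exact EReal.coe_ne_bot _ this
    refine ⟨hp, fun r hr => ?_⟩
    have := h r
    rw [hopfPhi_eq_coe H t x hp, hopfPhi_eq_coe H t x hr] at this
    exact EReal.coe_le_coe_iff.1 this
  · intro h q
    by_cases hq : q ∈ conjDom σ
    · rw [hopfPhi_eq_coe H t x h.1, hopfPhi_eq_coe H t x hq]
      exact EReal.coe_le_coe_iff.2 (h.2 q hq)
    · rw [hopfPhi_eq_bot H t x hq]
      exact bot_le

theorem hopfU_eq {H : ℝ → 𝔼 → ℝ} {σ : 𝔼 → ℝ} {t : ℝ} {x p : 𝔼}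
    (hp : IsConjMax σ (fun q => inner ℝ x q - ∫ τ in (0 : ℝ)..t, H τ q) p) :
    hopfU H σ t x = inner ℝ x p - (∫ τ in (0 : ℝ)..t, H τ p) - conjVal σ p := by
  have hsup : ⨆ q, hopfPhi H σ t x q = hopfPhi H σ t x p :=
    le_antisymm (iSup_le ((mem_hopfMaximizers_iff ⟨p, hp.1⟩).2 hp)) (le_iSup _ p)
  rw [hopfU, hsup, hopfPhi_eq_coe H t x hp.1, EReal.toReal_coe]

theorem isGreatest_hopfU {H : ℝ → 𝔼 → ℝ} {σ : 𝔼 → ℝ} {t : ℝ} {x p : 𝔼}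
    (hp : IsConjMax σ (fun q => inner ℝ x q - ∫ τ in (0 : ℝ)..t, H τ q) p) :
    IsGreatest (range (hopfPhi H σ t x)) (hopfU H σ t x : EReal) := by
  rw [hopfU_eq hp, ← hopfPhi_eq_coe H t x hp.1]
  refine ⟨⟨p, rfl⟩, ?_⟩
  rintro _ ⟨q, rfl⟩
  exact (mem_hopfMaximizers_iff ⟨p, hp.1⟩).2 hp q

theorem conjDom_nonempty {σ : 𝔼 → ℝ} (hσd : Differentiable ℝ σ) (hσc : ConvexOn ℝ univ σ) :
    (conjDom σ).Nonempty := by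
  refine ⟨(InnerProductSpace.toDual ℝ 𝔼).symm (fderiv ℝ σ 0), mem_conjDom (c := -σ 0) fun y => ?_⟩
  have := hσc.add_fderiv_le (hσd 0).hasFDerivAt y
  rw [real_inner_comm, InnerProductSpace.toDual_symm_apply]
  rw [sub_zero] at this
  linarith

/-- Uniqueness of the maximizers in the Hopf formula propagates backwards in time. -/
theorem isConjMax_unique_of_later {T : ℝ} {H : ℝ → 𝔼 → ℝ} {A : ℝ → 𝔼 → 𝔼 →L[ℝ] ℝ} {σ : 𝔼 → ℝ}
    (hH : Continuous fun z : ℝ × 𝔼 => H z.1 z.2) (hA : Continuous fun z : ℝ × 𝔼 => A z.1 z.2)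
    (hHA : ∀ τ q, HasFDerivAt (H τ) (A τ q) q)
    (hσd : Differentiable ℝ σ) (hσc : ConvexOn ℝ univ σ) {K : NNReal} (hσL : LipschitzWith K σ)
    (hA2 : CondA2 T H) {s t : ℝ} (hs : 0 ≤ s) (hst : s ≤ t) (htT : t ≤ T)
    (huniq : ∀ x, ∃ p, ∀ q,
      IsConjMax σ (fun r => inner ℝ x r - ∫ τ in (0 : ℝ)..t, H τ r) q ↔ q = p)
    {x p₁ p₂ : 𝔼} (h₁ : IsConjMax σ (fun q => inner ℝ x q - ∫ τ in (0 : ℝ)..s, H τ q) p₁)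
    (h₂ : IsConjMax σ (fun q => inner ℝ x q - ∫ τ in (0 : ℝ)..s, H τ q) p₂) : p₁ = p₂ := by
  have hd := differentiable_timeIntegral hH hA hHA
  have hconv := convexOn_conjVal_add hσL (hd t).continuous huniq
  rcases hA2 with (hcx | hcv) | ⟨g, h, k, hsep, hg⟩
  · refine h₁.unique_of_midpoint_convex hσd hσc (hd s) one_pos (fun q₁ _ q₂ _ => ?_) h₂
    have := timeIntegral_midpoint_le hH hs
      (fun τ hτ => hcx τ ⟨hτ.1, hτ.2.trans_le (hst.trans htT)⟩) q₁ q₂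
    simpa using this
  · refine h₁.unique_of_sub_midpoint_convex (hd s) (hd t) hconv huniq (fun q₁ q₂ => ?_) h₂
    have := timeIntegral_midpoint_le (H := fun τ q => -H τ q) hH.neg hst
      (fun τ hτ => (hcv τ ⟨hs.trans_lt hτ.1, hτ.2.trans_le htT⟩).neg) q₁ q₂
    simp only [intervalIntegral.integral_neg] at this
    have hsub := fun q => timeIntegral_sub hH q s t
    linarith [hsub q₁, hsub q₂, hsub ((1 / 2 : ℝ) • q₁ + (1 / 2 : ℝ) • q₂)]
  · obtain ⟨θ, c, hθ0, hθ1, hθ⟩ := timeIntegral_eq_mul_add_of_separable hH hsep hg hs hst htT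
    rcases hθ1.lt_or_eq with hlt | rfl
    · refine h₁.unique_of_midpoint_convex hσd hσc (hd s) (sub_pos.2 hlt) (fun q₁ hq₁ q₂ hq₂ => ?_)
        h₂
      have := mul_le_mul_of_nonneg_left (hconv.half_add_half_le hq₁ hq₂) hθ0
      simp only [hθ]
      linarith
    · obtain ⟨p, hp⟩ := huniq x
      have htrans : ∀ q, IsConjMax σ (fun q => inner ℝ x q - ∫ τ in (0 : ℝ)..s, H τ q) q →
          q = p := by
        refine fun q hq => (hp q).1 ⟨hq.1, fun r hr => ?_⟩
        have := hq.2 r hr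
        simp only [hθ] at this
        linarith
      rw [htrans p₁ h₁, htrans p₂ h₂]

theorem isGreatest_and_contDiffOn_hopfU {T : ℝ} {H : ℝ → 𝔼 → ℝ} {A : ℝ → 𝔼 → 𝔼 →L[ℝ] ℝ}
    {σ : 𝔼 → ℝ} (hH : Continuous fun z : ℝ × 𝔼 => H z.1 z.2)
    (hA : Continuous fun z : ℝ × 𝔼 => A z.1 z.2) (hHA : ∀ τ q, HasFDerivAt (H τ) (A τ q) q)
    (hσd : Differentiable ℝ σ) (hσc : ConvexOn ℝ univ σ) {K : NNReal} (hσL : LipschitzWith K σ)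
    (hA2 : CondA2 T H) {tstar : ℝ} (htT : tstar ≤ T)
    (hsing : ∀ x : 𝔼, ∃ p, hopfMaximizers H σ tstar x = {p}) :
    (∀ t ∈ Ioo 0 tstar, ∀ x : 𝔼,
      IsGreatest (range (hopfPhi H σ t x)) (hopfU H σ t x : EReal)) ∧
    ContDiffOn ℝ 1 (fun z : ℝ × 𝔼 => hopfU H σ z.1 z.2) (Ioo 0 tstar ×ˢ univ) := by
  have hne := conjDom_nonempty hσd hσc
  have hd := differentiable_timeIntegral hH hA hHA
  have huniq : ∀ x, ∃ p, ∀ q,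
      IsConjMax σ (fun r => inner ℝ x r - ∫ τ in (0 : ℝ)..tstar, H τ r) q ↔ q = p := by
    intro x
    obtain ⟨p, hp⟩ := hsing x
    exact ⟨p, fun q => by rw [← mem_hopfMaximizers_iff hne, hp, mem_singleton_iff]⟩
  have hex : ∀ z : ℝ × 𝔼, ∃ p,
      IsConjMax σ (fun q => inner ℝ z.2 q - ∫ τ in (0 : ℝ)..z.1, H τ q) p := fun z =>
    exists_isConjMax hσL hne ((differentiable_inner_right z.2).sub (hd z.1)).continuous
  choose P hP using hex
  refine ⟨fun t _ x => isGreatest_hopfU (H := H) (t := t) (x := x) (hP (t, x)), ?_⟩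
  let U : Set (ℝ × 𝔼) := Ioo 0 tstar ×ˢ univ
  have hUo : IsOpen U := isOpen_Ioo.prod isOpen_univ
  have hF := continuous_timeIntegral hH
  have hPc : ContinuousOn P U :=
    continuousOn_of_isConjMax hσL
      (b := fun (z : ℝ × 𝔼) (q : 𝔼) => inner ℝ z.2 q - ∫ τ in (0 : ℝ)..z.1, H τ q)
      (by
        have : Continuous fun w : (ℝ × 𝔼) × 𝔼 => ∫ τ in (0 : ℝ)..w.1.1, H τ w.2 :=
          hF.comp (by fun_prop : Continuous fun w : (ℝ × 𝔼) × 𝔼 => (w.1.1, w.2))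
        fun_prop)
      (fun z _ => hP z)
      (fun z hz q hq => isConjMax_unique_of_later hH hA hHA hσd hσc hσL hA2 hz.1.1.le hz.1.2.le
        htT huniq hq (hP z))
  have hC1 := contDiffOn_one_of_isConjMax
    (b := fun (z : ℝ × 𝔼) (q : 𝔼) => inner ℝ z.2 q - ∫ τ in (0 : ℝ)..z.1, H τ q) (σ := σ)
    (hasFDerivAt_hopfAction hH) (continuous_fderiv_hopfAction hH) hUo (fun z _ => hP z) hPc
  exact hC1.congr fun w _ => hopfU_eq (H := H) (t := w.1) (x := w.2) (hP w)

/-- A `C¹` function on `[0, T] × ℝⁿ` agrees there with a function on `ℝ × ℝⁿ` that is jointly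
continuous together with its derivative in the second variable. -/
theorem exists_global_extension {T : ℝ} (hT : 0 < T) {H : ℝ → 𝔼 → ℝ}
    (hH : ContDiffOn ℝ 1 (fun z : ℝ × 𝔼 => H z.1 z.2) (Icc 0 T ×ˢ univ)) :
    ∃ (H' : ℝ → 𝔼 → ℝ) (A : ℝ → 𝔼 → 𝔼 →L[ℝ] ℝ),
      (Continuous fun z : ℝ × 𝔼 => H' z.1 z.2) ∧ (Continuous fun z : ℝ × 𝔼 => A z.1 z.2) ∧
      (∀ τ q, HasFDerivAt (H' τ) (A τ q) q) ∧ ∀ τ ∈ Icc 0 T, H' τ = H τ := by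
  set S : Set (ℝ × 𝔼) := Icc 0 T ×ˢ univ with hS
  set f : ℝ × 𝔼 → ℝ := fun z => H z.1 z.2 with hf
  set π : ℝ × 𝔼 → ℝ × 𝔼 := fun z => ((projIcc 0 T hT.le z.1 : ℝ), z.2) with hπ
  have hπc : Continuous π :=
    ((continuous_subtype_val.comp continuous_projIcc).comp continuous_fst).prodMk continuous_snd
  have hπS : ∀ z, π z ∈ S := fun z => ⟨(projIcc 0 T hT.le z.1).2, mem_univ _⟩
  have hud : UniqueDiffOn ℝ S := (uniqueDiffOn_Icc hT).prod uniqueDiffOn_univ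
  refine ⟨fun τ q => f (π (τ, q)), fun τ q =>
    (fderivWithin ℝ f S (π (τ, q))).comp (ContinuousLinearMap.inr ℝ ℝ 𝔼),
    hH.continuousOn.comp_continuous hπc hπS, ?_, fun τ q => ?_, fun τ hτ => ?_⟩
  · exact ((hH.continuousOn_fderivWithin hud le_rfl).comp_continuous hπc hπS).clm_comp
      continuous_const
  · have h1 := ((hH.differentiableOn one_ne_zero) _ (hπS (τ, q))).hasFDerivWithinAt
    have h2 : HasFDerivWithinAt (fun q : 𝔼 => π (τ, q)) (ContinuousLinearMap.inr ℝ ℝ 𝔼) univ q :=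
      (hasFDerivAt_prodMk_right (projIcc 0 T hT.le τ : ℝ) q).hasFDerivWithinAt
    exact hasFDerivWithinAt_univ.1 (h1.comp q h2 fun r _ => hπS (τ, r))
  · funext q
    simp only [hπ, hf, projIcc_of_mem hT.le hτ]

end Hopf

theorem theorem3p2 {n : ℕ} (T : ℝ) (hT : 0 < T)
    (H : ℝ → EuclideanSpace ℝ (Fin n) → ℝ) (σ : EuclideanSpace ℝ (Fin n) → ℝ)
    (hH : ContDiffOn ℝ 1 (fun z : ℝ × EuclideanSpace ℝ (Fin n) => H z.1 z.2)
      (Set.Icc 0 T ×ˢ Set.univ))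
    (hσ : ContDiff ℝ 1 σ) (hσconv : ConvexOn ℝ Set.univ σ)
    (hA1 : CondA1 T H σ) (hA2 : CondA2 T H)
    (hσLip : ∃ K : NNReal, LipschitzWith K σ)
    (tstar : ℝ) (htpos : 0 < tstar) (htT : tstar ≤ T)
    (hsing : ∀ x : EuclideanSpace ℝ (Fin n), ∃ p, hopfMaximizers H σ tstar x = {p}) :
    (∀ t ∈ Set.Ioo 0 tstar, ∀ x : EuclideanSpace ℝ (Fin n),
      IsGreatest (Set.range (hopfPhi H σ t x)) (hopfU H σ t x : EReal)) ∧
    ContDiffOn ℝ 1 (fun z : ℝ × EuclideanSpace ℝ (Fin n) => hopfU H σ z.1 z.2)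
      (Set.Ioo 0 tstar ×ˢ Set.univ) := by
  obtain ⟨H', A, hc, hA, hHA, heq⟩ := exists_global_extension hT hH
  obtain ⟨K, hK⟩ := hσLip
  have hphi : ∀ t ∈ Icc 0 tstar, hopfPhi H' σ t = hopfPhi H σ t := by
    intro t ht
    funext x q
    have : ∫ τ in (0 : ℝ)..t, H' τ q = ∫ τ in (0 : ℝ)..t, H τ q :=
      intervalIntegral.integral_congr fun τ hτ => by
        rw [uIcc_of_le ht.1] at hτ
        exact congrFun (heq τ ⟨hτ.1, hτ.2.trans (ht.2.trans htT)⟩) q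
    rw [hopfPhi, hopfPhi, this]
  have hU : ∀ t ∈ Ioo 0 tstar, hopfU H' σ t = hopfU H σ t := fun t ht => by
    funext x
    rw [hopfU, hopfU, hphi t (Ioo_subset_Icc_self ht)]
  have hA2' : CondA2 T H' := by
    have hcongr : ∀ t ∈ Ioo 0 T, H' t = H t := fun t ht => heq t (Ioo_subset_Icc_self ht)
    rcases hA2 with (h | h) | ⟨g, h, k, hsep, hg⟩
    · exact .inl (.inl fun t ht => hcongr t ht ▸ h t ht)
    · exact .inl (.inr fun t ht => hcongr t ht ▸ h t ht)
    · exact .inr ⟨g, h, k, fun t ht p => hcongr t ht ▸ hsep t ht p, hg⟩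
  obtain ⟨hmax, hdiff⟩ := isGreatest_and_contDiffOn_hopfU hc hA hHA
    (hσ.differentiable one_ne_zero) hσconv hK hA2' htT (fun x => by
      obtain ⟨p, hp⟩ := hsing x
      refine ⟨p, ?_⟩
      rw [← hp, hopfMaximizers, hopfMaximizers, hphi tstar ⟨htpos.le, le_rfl⟩])
  refine ⟨fun t ht x => ?_, hdiff.congr fun z hz => ?_⟩
  · rw [← hU t ht, ← hphi t (Ioo_subset_Icc_self ht)]
    exact hmax t ht x
  · simp only [hU z.1 hz.1]
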